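/- A tropical affine manifold of dimension $n$ is a smooth manifold $B$ (Hausdorff, second countable, not necessarily compact or connected) with an atlas of charts to $\mathbb{R}^n$ whose transition maps are locally of the form $x\mapsto Ax+b$ with $A\in \mathrm{GL}(n,\mathbb{Z})$ and $b\in\mathbb{R}^n$. It carries a lattice $T_{\mathbb Z}B\subset TB$ of integral tangent vectors and the local system $T^*_{\mathbb Z}B$ of locally constant $1$-forms that are integral on $T_{\mathbb Z}B$. A tropical $p$-form is a global section of $\wedge^pT^*_{\mathbb Z}B$. A parametrized tropical curve in $B\times\mathbb{R}$ is a proper embedding $h:\Gamma\to B\times\mathbb{R}$ of a finite graph $\Gamma$ without $1$-valent or isolated vertices, whose bounded edges are intervals $[0,\ell_e]$ and whose semi-infinite edges are rays $[0,\infty)$, such that (i) $h$ is integral affine on each edge $e$, that is, $dh(T_{\mathbb Z}e)\subset T_{\mathbb Z}(B\times\mathbb{R})$, and (ii) at each vertex $v$ one has $\sum_{e\to v}dh(z_e)=0$, where the sum is over the edge ends at $v$ and $z_e$ is the primitive vector on $e$ pointing outwards from $v$. The weight $w_e$ of an edge is the divisibility of $dh(z_e)$ in the lattice. The curve is horizontal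 at infinity if $pr_B\circ h$ is constant, say equal to $b_e$, on each semi-infinite edge $e$; its cycle is then $$\sum_{e\in E_{+\infty}}w_e\,b_e-\sum_{e\in E_{-\infty}}w_e\,b_e\in Z_0(B),$$ where $E_{\pm\infty}$ is the set of semi-infinite edges asymptotic to $B\times\{\pm\infty\}$ and $Z_0(B)$ is the free abelian group on the points of $B$. Let $R_0(B)\subset Z_0(B)$ be the subgroup generated by the cycles of all such curves, $CH_0(B)=Z_0(B)/R_0(B)$, and let $CH_0(B)_{\hom}$ be the subgroup of classes of cycles of degree zero. Theorem. Let $B$ be a tropical affine manifold that admits a non-zero tropical $p$-form for some $p\ge 2$. Then $CH_0(B)_{\hom}$ is infinite-dimensional in Mumford's sense: for no $k\in\mathbb{N}$ is the map $$B^k\times B^k\to CH_0(B)_{\hom},\qquad (\mathbf b^+,\mathbf b^-)\mapsto\sum_{i=1}^k(b_i^+-b_i^-)$$ surjective. -/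

import Mathlib

open Topology
open scoped Matrix

namespace TropicalChow

/-- A tropical (integral) affine structure of dimension `n` on `B`: an atlas of charts to `ℝⁿ` all of
whose transition maps are locally of the form `x ↦ A x + b` with `A ∈ GL(n, ℤ)` and `b ∈ ℝⁿ`. -/
class TropicalAffineManifold (n : ℕ) (B : Type*) [TopologicalSpace B]
    [ChartedSpace (Fin n → ℝ) B] : Prop where
  transition : ∀ e ∈ atlas (Fin n → ℝ) B, ∀ e' ∈ atlas (Fin n → ℝ) B,
    ∀ x ∈ (e.symm.trans e').source, ∃ (A : GL (Fin n) ℤ) (b : Fin n → ℝ),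
      ∀ᶠ y in 𝓝 x, e' (e.symm y) = ((A : Matrix (Fin n) (Fin n) ℤ).map (Int.cast : ℤ → ℝ)) *ᵥ y + b

/-- A tropical `p`-form on `B`: a global section of `⋀ᵖ T*_ℤ B`. The tangent space at `x` is
identified with `ℝⁿ`, and the lattice of integral tangent vectors at `x` with `ℤⁿ`, through the
preferred chart at `x`. A section is a family of alternating forms that take integral values on
integral tangent vectors and that are locally constant in affine coordinates. -/
structure TropicalForm (n : ℕ) (B : Type*) [TopologicalSpace B] [ChartedSpace (Fin n → ℝ) B]
    (p : ℕ) where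
  /-- the value of the form at a point -/
  toFun : B → (Fin n → ℝ) [⋀^Fin p]→ₗ[ℝ] ℝ
  integral : ∀ (x : B) (v : Fin p → Fin n → ℤ), ∃ m : ℤ, toFun x (fun i j => (v i j : ℝ)) = m
  locallyConstant : ∀ x : B, ∀ᶠ y in 𝓝 x, ∀ v : Fin p → Fin n → ℝ,
    toFun y v = toFun x (fun i =>
      fderiv ℝ (chartAt (Fin n → ℝ) x ∘ (chartAt (Fin n → ℝ) y).symm)
        (chartAt (Fin n → ℝ) y y) (v i))

/-- An abstract tropical curve: a finite graph (loops, multiple edges and several connected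
components are allowed) with bounded edges and semi-infinite edges and without vertices of valence
less than two, together with a complete tropical structure on its edges: a bounded edge `e` is the
interval `[0, len e]`, a semi-infinite edge is the ray `[0, ∞)` starting at the vertex `root`. -/
structure AbstractTropicalCurve where
  /-- number of vertices -/
  numV : ℕ
  /-- number of bounded edges -/
  numE : ℕ
  /-- number of semi-infinite edges -/
  numU : ℕ
  /-- initial vertex of a bounded edge, for a chosen orientation -/
  src : Fin numE → Fin numV
  /-- final vertex of a bounded edge -/
  tgt : Fin numE → Fin numV
  /-- the vertex from which a semi-infinite edge emanates -/
  root : Fin numU → Fin numV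
  /-- length of a bounded edge -/
  len : Fin numE → ℝ
  len_pos : ∀ e, 0 < len e
  two_le_valence : ∀ v, 2 ≤ (Finset.univ.filter (fun e => src e = v)).card +
    (Finset.univ.filter (fun e => tgt e = v)).card +
    (Finset.univ.filter (fun u => root u = v)).card

namespace AbstractTropicalCurve

variable (G : AbstractTropicalCurve)

/-- The disjoint union of the vertices, the closed bounded edges and the closed rays. -/
abbrev Pieces : Type :=
  Fin G.numV ⊕ (Σ e : Fin G.numE, Set.Icc (0 : ℝ) (G.len e)) ⊕ (Σ _u : Fin G.numU, Set.Ici (0 : ℝ))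

/-- The initial point of a bounded edge. -/
def first (e : Fin G.numE) : Set.Icc (0 : ℝ) (G.len e) := ⟨0, le_refl 0, (G.len_pos e).le⟩

/-- The final point of a bounded edge. -/
def last (e : Fin G.numE) : Set.Icc (0 : ℝ) (G.len e) := ⟨G.len e, (G.len_pos e).le, le_refl _⟩

/-- The initial point of a ray. -/
def origin : Set.Ici (0 : ℝ) := ⟨0, Set.mem_Ici.2 le_rfl⟩

/-- The end points of edges are glued to the corresponding vertices. -/
inductive Glue : G.Pieces → G.Pieces → Prop
  | src (e : Fin G.numE) : Glue (Sum.inr (Sum.inl ⟨e, G.first e⟩)) (Sum.inl (G.src e))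
  | tgt (e : Fin G.numE) : Glue (Sum.inr (Sum.inl ⟨e, G.last e⟩)) (Sum.inl (G.tgt e))
  | root (u : Fin G.numU) : Glue (Sum.inr (Sum.inr ⟨u, origin⟩)) (Sum.inl (G.root u))

/-- The topological space underlying the curve, with the quotient topology. -/
abbrev Realization : Type := Quot G.Glue

/-- The point of the curve given by a vertex. -/
def vertexPt (v : Fin G.numV) : G.Realization := Quot.mk _ (Sum.inl v)

/-- The points of a bounded edge. -/
def edgePt (e : Fin G.numE) (t : Set.Icc (0 : ℝ) (G.len e)) : G.Realization :=
  Quot.mk _ (Sum.inr (Sum.inl ⟨e, t⟩))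

/-- The points of a semi-infinite edge. -/
def rayPt (u : Fin G.numU) (t : Set.Ici (0 : ℝ)) : G.Realization :=
  Quot.mk _ (Sum.inr (Sum.inr ⟨u, t⟩))

end AbstractTropicalCurve

/-- The path `γ : I → B × ℝ` is, near the parameter `t`, affine with the integral velocity
`z ∈ T_ℤ (B × ℝ) = ℤⁿ × ℤ`, read in the preferred chart at the point `γ t`. -/
def HasIntegralVelocity {n : ℕ} {B : Type*} [TopologicalSpace B] [ChartedSpace (Fin n → ℝ) B]
    {I : Set ℝ} (γ : I → B × ℝ) (t : I) (z : (Fin n → ℤ) × ℤ) : Prop :=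
  ∀ᶠ s in 𝓝 t,
    (γ s).1 ∈ (chartAt (Fin n → ℝ) (γ t).1).source ∧
    chartAt (Fin n → ℝ) (γ t).1 (γ s).1 =
      chartAt (Fin n → ℝ) (γ t).1 (γ t).1 + ((s : ℝ) - (t : ℝ)) • (fun i => (z.1 i : ℝ)) ∧
    (γ s).2 = (γ t).2 + ((s : ℝ) - (t : ℝ)) * (z.2 : ℝ)

/-- A parametrized tropical curve in `B × ℝ`: a proper (that is, closed) embedding of an abstract
tropical curve that is integral affine on every edge and balanced at every vertex. The velocities
are the images under `dh` of the positive unit tangent vector of the edge; they are determined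
by the map. At a vertex `v`, the outward primitive vector of an edge is the positive unit vector at
an initial end and the negative one at a final end (a loop contributes both of its ends). -/
structure TropicalCurve (n : ℕ) (B : Type*) [TopologicalSpace B]
    [ChartedSpace (Fin n → ℝ) B] where
  /-- the abstract tropical curve -/
  G : AbstractTropicalCurve
  /-- the parametrization -/
  h : G.Realization → B × ℝ
  isClosedEmbedding : IsClosedEmbedding h
  /-- velocity along the bounded edges -/
  edgeVel : ∀ e : Fin G.numE, Set.Icc (0 : ℝ) (G.len e) → (Fin n → ℤ) × ℤ
  /-- velocity along the semi-infinite edges -/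
  rayVel : Fin G.numU → Set.Ici (0 : ℝ) → (Fin n → ℤ) × ℤ
  edge_affine : ∀ e t, HasIntegralVelocity (fun s => h (G.edgePt e s)) t (edgeVel e t)
  ray_affine : ∀ u t, HasIntegralVelocity (fun s => h (G.rayPt u s)) t (rayVel u t)
  balanced : ∀ v : Fin G.numV,
    ∑ e ∈ Finset.univ.filter (fun e => G.src e = v), edgeVel e (G.first e)
      - ∑ e ∈ Finset.univ.filter (fun e => G.tgt e = v), edgeVel e (G.last e)
      + ∑ u ∈ Finset.univ.filter (fun u => G.root u = v),
          rayVel u AbstractTropicalCurve.origin = 0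

section Chow

variable (n : ℕ) (B : Type*) [TopologicalSpace B] [ChartedSpace (Fin n → ℝ) B]

namespace TropicalCurve

variable {n B}

/-- The point of `B` over which a semi-infinite edge starts (and over which the whole edge lies, if
the curve is horizontal at infinity). -/
def endPoint (C : TropicalCurve n B) (u : Fin C.G.numU) : B :=
  (C.h (C.G.rayPt u AbstractTropicalCurve.origin)).1

/-- The projection to `B` is constant on every semi-infinite edge. -/
def HorizontalAtInfinity (C : TropicalCurve n B) : Prop :=
  ∀ (u : Fin C.G.numU) (t : Set.Ici (0 : ℝ)), (C.h (C.G.rayPt u t)).1 = C.endPoint u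

/-- The weight of a semi-infinite edge, namely the divisibility of its velocity vector in the
lattice `ℤⁿ × ℤ`. -/
def weight (C : TropicalCurve n B) (u : Fin C.G.numU) : ℕ :=
  Nat.gcd (Finset.univ.gcd fun i => ((C.rayVel u AbstractTropicalCurve.origin).1 i).natAbs)
    (C.rayVel u AbstractTropicalCurve.origin).2.natAbs

/-- The semi-infinite edges asymptotic to `B × {+∞}`. -/
def endsPlus (C : TropicalCurve n B) : Finset (Fin C.G.numU) :=
  Finset.univ.filter fun u => 0 < (C.rayVel u AbstractTropicalCurve.origin).2

/-- The semi-infinite edges asymptotic to `B × {-∞}`. -/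
def endsMinus (C : TropicalCurve n B) : Finset (Fin C.G.numU) :=
  Finset.univ.filter fun u => (C.rayVel u AbstractTropicalCurve.origin).2 < 0

/-- The `0`-cycle cut out at `+∞` minus the one cut out at `-∞`, with multiplicities. -/
noncomputable def cycle (C : TropicalCurve n B) : B →₀ ℤ :=
  ∑ u ∈ C.endsPlus, Finsupp.single (C.endPoint u) (C.weight u : ℤ)
    - ∑ u ∈ C.endsMinus, Finsupp.single (C.endPoint u) (C.weight u : ℤ)

end TropicalCurve

/-- The subgroup `R₀(B)` of `Z₀(B) = ℤ[B]` generated by the cycles of the tropical curves in `B × ℝ`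
that are horizontal at infinity. -/
noncomputable def relations : AddSubgroup (B →₀ ℤ) :=
  AddSubgroup.closure {c | ∃ C : TropicalCurve n B, C.HorizontalAtInfinity ∧ C.cycle = c}

/-- The tropical Chow group of points `CH₀(B) = Z₀(B) / R₀(B)`. -/
abbrev Chow : Type _ := (B →₀ ℤ) ⧸ relations n B

/-- The degree of a `0`-cycle. -/
noncomputable def degree : (B →₀ ℤ) →+ ℤ := Finsupp.liftAddHom fun _ => AddMonoidHom.id ℤ

/-- The subgroup `CH₀(B)_hom` of the classes of the `0`-cycles of degree zero. -/
noncomputable def ChowHom : AddSubgroup (Chow n B) :=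
  (degree B).ker.map (QuotientAddGroup.mk' (relations n B))

/-- The `0`-cycle `∑ᵢ (bᵢ⁺ - bᵢ⁻)`. -/
noncomputable def diffCycle {B : Type*} {k : ℕ} (b : (Fin k → B) × (Fin k → B)) : B →₀ ℤ :=
  ∑ i, (Finsupp.single (b.1 i) 1 - Finsupp.single (b.2 i) 1)

theorem diffCycle_mem {B : Type*} {k : ℕ} (b : (Fin k → B) × (Fin k → B)) :
    diffCycle b ∈ (degree B).ker := by
  rw [AddMonoidHom.mem_ker, diffCycle, map_sum]
  refine Finset.sum_eq_zero fun i _ => ?_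
  rw [map_sub, degree, Finsupp.liftAddHom_apply_single, Finsupp.liftAddHom_apply_single]
  simp

/-- The map `Bᵏ × Bᵏ → CH₀(B)_hom`, `(b⁺, b⁻) ↦ ∑ᵢ (bᵢ⁺ - bᵢ⁻)`. -/
noncomputable def diffMap (k : ℕ) (b : (Fin k → B) × (Fin k → B)) : ChowHom n B :=
  ⟨QuotientAddGroup.mk' (relations n B) (diffCycle b),
    AddSubgroup.mem_map_of_mem _ (diffCycle_mem b)⟩

/-- `CH₀(B)_hom` is infinite-dimensional in the sense of Mumford. -/
def InfiniteDimensional : Prop := ∀ k : ℕ, ¬ Function.Surjective (diffMap n B k)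

end Chow

end TropicalChow

namespace TropicalChow

section Forms

variable {n p : ℕ}

/-- The `(p + 1)`-form `dt ∧ f` on `ℝⁿ × ℝ`. -/
noncomputable def wedgeHeight (f : (Fin n → ℝ) [⋀^Fin p]→ₗ[ℝ] ℝ) :
    ((Fin n → ℝ) × ℝ) [⋀^Fin (p + 1)]→ₗ[ℝ] ℝ :=
  AlternatingMap.alternatizeUncurryFin
    ((LinearMap.snd ℝ (Fin n → ℝ) ℝ).smulRight (f.compLinearMap (LinearMap.fst ℝ (Fin n → ℝ) ℝ)))

theorem wedgeHeight_apply (f : (Fin n → ℝ) [⋀^Fin p]→ₗ[ℝ] ℝ) (v : Fin (p + 1) → (Fin n → ℝ) × ℝ) :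
    wedgeHeight f v = ∑ i : Fin (p + 1), (-1 : ℤ) ^ (i : ℕ) • ((v i).2 * f fun j => (i.removeNth v j).1) := by
  simp only [wedgeHeight, AlternatingMap.alternatizeUncurryFin_apply]
  rfl

theorem wedgeHeight_curryLeft_vertical (f : (Fin n → ℝ) [⋀^Fin p]→ₗ[ℝ] ℝ) (w : ℝ)
    (V : Fin p → (Fin n → ℝ) × ℝ) :
    (wedgeHeight f).curryLeft (0, w) V = w * f fun i => (V i).1 := by
  rw [AlternatingMap.curryLeft_apply_apply, wedgeHeight_apply, Fin.sum_univ_succ]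
  rw [Finset.sum_eq_zero]
  · simp
  · intro i _
    obtain _ | p := p
    · exact i.elim0
    · rw [f.map_coord_zero (i := 0)]
      · simp
      · simp [Fin.removeNth, Matrix.vecCons]

theorem wedgeHeight_curryLeft_map {f f' : (Fin n → ℝ) [⋀^Fin p]→ₗ[ℝ] ℝ}
    {L : (Fin n → ℝ) →ₗ[ℝ] (Fin n → ℝ)} (h : ∀ v, f v = f' fun i => L (v i)) (z : (Fin n → ℝ) × ℝ)
    (V : Fin p → (Fin n → ℝ) × ℝ) :
    (wedgeHeight f).curryLeft z V =
      (wedgeHeight f').curryLeft (L z.1, z.2) fun i => (L (V i).1, (V i).2) := by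
  rw [AlternatingMap.curryLeft_apply_apply, AlternatingMap.curryLeft_apply_apply]
  have : Matrix.vecCons ((L z.1, z.2) : (Fin n → ℝ) × ℝ) (fun i => (L (V i).1, (V i).2)) =
      fun i => (L (Matrix.vecCons z V i).1, (Matrix.vecCons z V i).2) := by
    funext i
    refine Fin.cases ?_ (fun j => ?_) i <;> simp
  rw [this, wedgeHeight_apply, wedgeHeight_apply]
  refine Finset.sum_congr rfl fun i _ => ?_
  rw [h]
  rfl

theorem curryLeft_add_smul {M : Type*} [AddCommGroup M] [Module ℝ M] (g : M [⋀^Fin (p + 1)]→ₗ[ℝ] ℝ)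
    (z : M) (V : Fin p → M) (c : Fin p → ℝ) :
    g.curryLeft z (fun i => V i + c i • z) = g.curryLeft z V := by
  classical
  have hz : ∀ (W : Fin p → M) (i : Fin p) (a : ℝ), W i = a • z → g.curryLeft z W = 0 := by
    intro W i a h
    have : W = Function.update W i (a • z) := by rw [← h, Function.update_eq_self]
    rw [this, AlternatingMap.map_update_smul, AlternatingMap.curryLeft_apply_apply,
      g.map_eq_zero_of_eq (i := 0) (j := i.succ), smul_zero]
    · simp
    · exact (Fin.succ_ne_zero i).symm
  have := (g.curryLeft z).toMultilinearMap.map_add_univ V (fun i => c i • z)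
  refine this.trans ((Finset.sum_eq_single Finset.univ (fun s _ hs => ?_) (by simp)).trans ?_)
  · obtain ⟨i, hi⟩ : ∃ i, i ∉ s := by
      by_contra! h
      exact hs (Finset.eq_univ_iff_forall.2 h)
    exact hz _ i (c i) (by simp [hi])
  · simp only [Finset.piecewise_univ]
    rfl

end Forms

section Charts

variable {n : ℕ} {B : Type*} [TopologicalSpace B] [ChartedSpace (Fin n → ℝ) B]

/-- The linear action of `GL(n, ℤ)` on `ℝⁿ`. -/
def realAction (A : GL (Fin n) ℤ) : (Fin n → ℝ) →ₗ[ℝ] (Fin n → ℝ) :=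
  ((A : Matrix (Fin n) (Fin n) ℤ).map (Int.cast : ℤ → ℝ)).mulVecLin

theorem realAction_intCast (A : GL (Fin n) ℤ) (z : Fin n → ℤ) :
    realAction A (fun i => (z i : ℝ)) =
      fun i => (((A : Matrix (Fin n) (Fin n) ℤ) *ᵥ z) i : ℝ) := by
  funext i
  simp [realAction, Matrix.mulVec, dotProduct]

theorem realAction_surjective (A : GL (Fin n) ℤ) : Function.Surjective (realAction A) := by
  intro v
  refine ⟨realAction A⁻¹ v, ?_⟩
  have h : ((A : Matrix (Fin n) (Fin n) ℤ) * ((A⁻¹ : GL (Fin n) ℤ) : Matrix (Fin n) (Fin n) ℤ)) = 1 := by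
    rw [← Units.val_mul, mul_inv_cancel]; rfl
  have h' := congrArg (fun M : Matrix (Fin n) (Fin n) ℤ => M.map (Int.castRingHom ℝ)) h
  simp only [Matrix.map_mul] at h'
  simp only [realAction, Matrix.mulVecLin_apply, Matrix.mulVec_mulVec]
  have h2 : (1 : Matrix (Fin n) (Fin n) ℤ).map (Int.castRingHom ℝ) = 1 :=
    Matrix.map_one _ (map_zero _) (map_one _)
  rw [h2] at h'
  exact (congrArg (· *ᵥ v) h').trans (Matrix.one_mulVec v)

theorem exists_affine_transition [TropicalAffineManifold n B] {c c' x : B}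
    (hx : x ∈ (chartAt (Fin n → ℝ) c).source) (hx' : x ∈ (chartAt (Fin n → ℝ) c').source) :
    ∃ (A : GL (Fin n) ℤ) (b : Fin n → ℝ), ∀ᶠ y in 𝓝 x,
      chartAt (Fin n → ℝ) c' y = realAction A (chartAt (Fin n → ℝ) c y) + b := by
  obtain ⟨A, b, h⟩ := TropicalAffineManifold.transition (n := n) (B := B) _
    (chart_mem_atlas _ c) _ (chart_mem_atlas _ c') (chartAt (Fin n → ℝ) c x)
    (by simp [hx, hx'])
  refine ⟨A, b, ?_⟩
  filter_upwards [((chartAt (Fin n → ℝ) c).continuousAt hx).eventually h,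
    (chartAt (Fin n → ℝ) c).open_source.mem_nhds hx] with y hy hys
  rw [(chartAt (Fin n → ℝ) c).left_inv hys] at hy
  exact hy

theorem fderiv_chart_comp_symm {c x : B}
    {A : GL (Fin n) ℤ} {b : Fin n → ℝ}
    (h : ∀ᶠ y in 𝓝 x, chartAt (Fin n → ℝ) c y = realAction A (chartAt (Fin n → ℝ) x y) + b)
    (v : Fin n → ℝ) :
    fderiv ℝ (chartAt (Fin n → ℝ) c ∘ (chartAt (Fin n → ℝ) x).symm) (chartAt (Fin n → ℝ) x x) v =
      realAction A v := by
  have hs := (chartAt (Fin n → ℝ) x).map_source (mem_chart_source _ x)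
  have hc := ((chartAt (Fin n → ℝ) x).continuousAt_symm hs)
  rw [ContinuousAt, (chartAt (Fin n → ℝ) x).left_inv (mem_chart_source _ x)] at hc
  have he : (chartAt (Fin n → ℝ) c ∘ (chartAt (Fin n → ℝ) x).symm)
      =ᶠ[𝓝 (chartAt (Fin n → ℝ) x x)] fun y => (realAction A).toContinuousLinearMap y + b := by
    filter_upwards [hc.eventually h, (chartAt (Fin n → ℝ) x).open_target.mem_nhds hs] with y hy hyt
    rw [(chartAt (Fin n → ℝ) x).right_inv hyt] at hy
    exact hy
  rw [he.fderiv_eq, fderiv_add_const, ContinuousLinearMap.fderiv]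
  rfl

variable {p : ℕ} (ω : TropicalForm n B p)

/-- The largest open subset of the domain of the preferred chart at `c` on which `ω` has constant
coefficients. -/
def TropicalForm.flatNhd (c : B) : Set B :=
  interior ((chartAt (Fin n → ℝ) c).source ∩ {y | ∀ v : Fin p → Fin n → ℝ,
    ω.toFun y v = ω.toFun c (fun i =>
      fderiv ℝ (chartAt (Fin n → ℝ) c ∘ (chartAt (Fin n → ℝ) y).symm)
        (chartAt (Fin n → ℝ) y y) (v i))})

theorem TropicalForm.isOpen_flatNhd (c : B) : IsOpen (ω.flatNhd c) := isOpen_interior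

theorem TropicalForm.flatNhd_mem_nhds (c : B) : ω.flatNhd c ∈ 𝓝 c :=
  interior_mem_nhds.2 (Filter.inter_mem (chart_source_mem_nhds _ c) (ω.locallyConstant c))

theorem TropicalForm.flatNhd_subset (c : B) : ω.flatNhd c ⊆ (chartAt (Fin n → ℝ) c).source :=
  fun _ h => (interior_subset h).1

variable [TropicalAffineManifold n B]

theorem TropicalForm.toFun_change {c c' x : B} (hx : x ∈ ω.flatNhd c) (hx' : x ∈ ω.flatNhd c')
    {A : GL (Fin n) ℤ} {b : Fin n → ℝ}
    (h : ∀ᶠ y in 𝓝 x, chartAt (Fin n → ℝ) c' y = realAction A (chartAt (Fin n → ℝ) c y) + b)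
    (v : Fin p → Fin n → ℝ) : ω.toFun c v = ω.toFun c' fun i => realAction A (v i) := by
  have hc := interior_subset hx
  have hc' := interior_subset hx'
  obtain ⟨A₁, b₁, h₁⟩ := exists_affine_transition (mem_chart_source (Fin n → ℝ) x) hc.1
  obtain ⟨A₂, b₂, h₂⟩ := exists_affine_transition (mem_chart_source (Fin n → ℝ) x) hc'.1
  choose u hu using fun i => realAction_surjective A₁ (v i)
  have h₃ : ∀ᶠ y in 𝓝 x, chartAt (Fin n → ℝ) c' y =
      realAction (A * A₁) (chartAt (Fin n → ℝ) x y) + (realAction A b₁ + b) := by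
    filter_upwards [h, h₁] with y hy hy₁
    rw [hy, hy₁, map_add, add_assoc]
    congr 1
    simp [realAction, Matrix.map_mul_intCast]
  have e₁ := hc.2 u
  have e₂ := hc'.2 u
  simp only [fderiv_chart_comp_symm h₁] at e₁
  simp only [fderiv_chart_comp_symm h₃] at e₂
  rw [e₁] at e₂
  rw [← funext hu, e₂]
  congr 1
  funext i
  simp [realAction, Matrix.map_mul_intCast]

end Charts

section Velocity

variable {n : ℕ} {B : Type*} [TopologicalSpace B] [ChartedSpace (Fin n → ℝ) B]

/-- The inclusion of the lattice `ℤⁿ × ℤ` into `ℝⁿ × ℝ`. -/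
def castVel : ((Fin n → ℤ) × ℤ) →+ (Fin n → ℝ) × ℝ where
  toFun z := (fun i => (z.1 i : ℝ), (z.2 : ℝ))
  map_zero' := by ext <;> simp
  map_add' z z' := by ext <;> simp

theorem castVel_apply (z : (Fin n → ℤ) × ℤ) :
    castVel z = (fun i => (z.1 i : ℝ), (z.2 : ℝ)) := rfl

theorem castVel_injective : Function.Injective (castVel (n := n)) := by
  intro z z' h
  simp only [castVel_apply, Prod.mk.injEq, funext_iff, Int.cast_inj] at h
  exact Prod.ext (funext h.1) h.2

/-- The action of `GL(n, ℤ)` on `ℤⁿ × ℤ` through the first factor. -/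
def velAction (A : GL (Fin n) ℤ) : ((Fin n → ℤ) × ℤ) →+ (Fin n → ℤ) × ℤ where
  toFun z := ((A : Matrix (Fin n) (Fin n) ℤ) *ᵥ z.1, z.2)
  map_zero' := by ext <;> simp
  map_add' z z' := by simp [Matrix.mulVec_add]

theorem velAction_apply (A : GL (Fin n) ℤ) (z : (Fin n → ℤ) × ℤ) :
    velAction A z = ((A : Matrix (Fin n) (Fin n) ℤ) *ᵥ z.1, z.2) := rfl

theorem castVel_velAction (A : GL (Fin n) ℤ) (z : (Fin n → ℤ) × ℤ) :
    castVel (velAction A z) = (realAction A (castVel z).1, (castVel z).2) := by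
  rw [castVel_apply, castVel_apply, realAction_intCast, velAction_apply]

/-- The coordinates of a point of `B × ℝ` in the preferred chart at `c`. -/
def coord (c : B) (x : B × ℝ) : (Fin n → ℝ) × ℝ := (chartAt (Fin n → ℝ) c x.1, x.2)

/-- The path `γ` is affine near `t`, with velocity `z` in the preferred chart at `c`. -/
def HasVelocityIn {I : Set ℝ} (c : B) (γ : I → B × ℝ) (t : I) (z : (Fin n → ℤ) × ℤ) : Prop :=
  ∀ᶠ s in 𝓝 t, coord c (γ s) = coord c (γ t) + ((s : ℝ) - (t : ℝ)) • castVel z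

theorem HasIntegralVelocity.hasVelocityIn {I : Set ℝ} {γ : I → B × ℝ} {t : I}
    {z : (Fin n → ℤ) × ℤ} (h : HasIntegralVelocity γ t z) : HasVelocityIn (γ t).1 γ t z := by
  filter_upwards [h] with s hs
  exact Prod.ext hs.2.1 hs.2.2

theorem HasVelocityIn.change {I : Set ℝ} {c c' : B} {γ : I → B × ℝ} {t : I}
    {z : (Fin n → ℤ) × ℤ} (h : HasVelocityIn c γ t z) (hγ : Continuous γ)
    {A : GL (Fin n) ℤ} {b : Fin n → ℝ} (hA : ∀ᶠ y in 𝓝 (γ t).1,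
      chartAt (Fin n → ℝ) c' y = realAction A (chartAt (Fin n → ℝ) c y) + b) :
    HasVelocityIn c' γ t (velAction A z) := by
  have hc : Continuous fun s => (γ s).1 := continuous_fst.comp hγ
  filter_upwards [h, hc.continuousAt.eventually hA] with s hs hs'
  simp only [coord, Prod.ext_iff] at hs ⊢
  rw [castVel_velAction, hs', hA.self_of_nhds, hs.1]
  refine ⟨?_, hs.2⟩
  simp only [Prod.fst_add, Prod.smul_fst, map_add, map_smul]
  abel

theorem HasVelocityIn.unique {I : Set ℝ} {c : B} {γ : I → B × ℝ} {t : I} [(𝓝[≠] t).NeBot]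
    {z z' : (Fin n → ℤ) × ℤ} (h : HasVelocityIn c γ t z) (h' : HasVelocityIn c γ t z') :
    z = z' := by
  have hex : ∀ᶠ s in 𝓝[≠] t, coord c (γ s) = coord c (γ t) + ((s : ℝ) - (t : ℝ)) • castVel z ∧
      coord c (γ s) = coord c (γ t) + ((s : ℝ) - (t : ℝ)) • castVel z' ∧ s ≠ t := by
    filter_upwards [h.filter_mono nhdsWithin_le_nhds, h'.filter_mono nhdsWithin_le_nhds,
      self_mem_nhdsWithin] with s hs hs' hne using ⟨hs, hs', hne⟩
  obtain ⟨s, hs, hs', hne⟩ := hex.exists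
  rw [hs, add_right_inj] at hs'
  have : ((s : ℝ) - (t : ℝ)) ≠ 0 := sub_ne_zero.2 fun e => hne (Subtype.ext e)
  exact castVel_injective (smul_right_injective _ this hs')

theorem HasVelocityIn.eventually {I : Set ℝ} {c : B} {γ : I → B × ℝ} {t : I}
    {z : (Fin n → ℤ) × ℤ} (h : HasVelocityIn c γ t z) : ∀ᶠ s in 𝓝 t, HasVelocityIn c γ s z := by
  filter_upwards [h.eventually_nhds] with s hs
  filter_upwards [hs] with r hr
  rw [hr, hs.self_of_nhds, add_assoc, ← add_smul]
  congr 2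
  ring

end Velocity

section Cover

variable {n : ℕ} {B : Type*} [TopologicalSpace B] [ChartedSpace (Fin n → ℝ) B] {p : ℕ}

/-- A countable cover of `B` by charts in which `ω` has constant coefficients, with a choice of a
chart around each point, and a countable basis of the topology. -/
structure FlatCover (ω : TropicalForm n B p) where
  /-- the centres of the charts -/
  center : ℕ → B
  /-- a chart around a given point -/
  idx : B → ℕ
  /-- a basis of the topology -/
  basis : ℕ → Set B
  mem_idx : ∀ x, x ∈ ω.flatNhd (center (idx x))
  isOpen_basis : ∀ k, IsOpen (basis k)
  exists_basis : ∀ (x : B) (O : Set B), O ∈ 𝓝 x → ∃ k, x ∈ basis k ∧ basis k ⊆ O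

theorem exists_flatCover [SecondCountableTopology B] (ω : TropicalForm n B p) (x₀ : B) :
    ∃ K : FlatCover ω, ∀ x ∈ ω.flatNhd x₀, K.center (K.idx x) = x₀ := by
  classical
  obtain ⟨s, hs, hcov⟩ := TopologicalSpace.countable_cover_nhds ω.flatNhd_mem_nhds
  obtain ⟨𝓑, h𝓑, -, hb⟩ := TopologicalSpace.exists_countable_basis B
  obtain ⟨f, hf⟩ := (hs.insert x₀).exists_eq_range ⟨x₀, Set.mem_insert _ _⟩
  obtain ⟨U, hU⟩ := h𝓑.exists_eq_range (by
    obtain ⟨V, hV, -⟩ := hb.mem_nhds_iff.1 (Filter.univ_mem (f := 𝓝 x₀))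
    exact ⟨V, hV⟩)
  have hx₀ : ∃ i, f i = x₀ := by
    have : x₀ ∈ Set.range f := hf ▸ Set.mem_insert _ _
    exact this
  have hcov' : ∀ x, ∃ i, x ∈ ω.flatNhd (f i) := by
    intro x
    have : x ∈ ⋃ x ∈ s, ω.flatNhd x := hcov ▸ Set.mem_univ x
    simp only [Set.mem_iUnion] at this
    obtain ⟨c, hc, hx⟩ := this
    have : c ∈ Set.range f := hf ▸ Set.mem_insert_of_mem _ hc
    obtain ⟨i, rfl⟩ := this
    exact ⟨i, hx⟩
  choose i₀ hi₀ using hx₀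
  choose g hg using hcov'
  refine ⟨⟨f, fun x => if x ∈ ω.flatNhd x₀ then i₀ else g x, U, ?_, ?_, ?_⟩, ?_⟩
  · intro x
    split_ifs with h
    · rwa [hi₀]
    · exact hg x
  · exact fun k => hb.isOpen (hU ▸ Set.mem_range_self k)
  · intro x O hO
    obtain ⟨V, hV, hx, hVO⟩ := hb.mem_nhds_iff.1 hO
    obtain ⟨k, rfl⟩ : V ∈ Set.range U := hU ▸ hV
    exact ⟨k, hx, hVO⟩
  · intro x hx
    simp [hx, hi₀]

namespace FlatCover

variable {ω : TropicalForm n B p} (K : FlatCover ω)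

/-- A chart of the cover together with an integral vector, read in this chart. -/
abbrev State (n : ℕ) : Type := ℕ × ((Fin n → ℤ) × ℤ)

/-- On the `k`-th basic open set, the change of coordinates between two charts is affine and takes
the vector of the first state to the vector of the second one. -/
def Change (k : ℕ) (σ τ : State n) : Prop :=
  ∃ (A : GL (Fin n) ℤ) (b : Fin n → ℝ), τ.2 = velAction A σ.2 ∧
    ∀ x ∈ K.basis k, x ∈ ω.flatNhd (K.center σ.1) ∧ x ∈ ω.flatNhd (K.center τ.1) ∧
      chartAt (Fin n → ℝ) (K.center τ.1) x =
        realAction A (chartAt (Fin n → ℝ) (K.center σ.1) x) + b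

/-- Change coordinates at `x`, then move straight from `x` to `y` in the new chart. -/
def Step (k : ℕ) (σ τ : State n) (x y : B × ℝ) : Prop :=
  K.Change k σ τ ∧ x.1 ∈ K.basis k ∧
    ∃ l : ℝ, coord (K.center τ.1) y = coord (K.center τ.1) x + l • castVel τ.2

/-- A sequence of steps along which the charts and the velocities are prescribed. -/
def Chain : List (ℕ × State n) → State n → State n → B × ℝ → B × ℝ → Prop
  | [], σ, τ, x, y => σ = τ ∧ x = y
  | (k, ρ) :: L, σ, τ, x, y => ∃ x', K.Step k σ ρ x x' ∧ Chain L ρ τ x' y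

variable {K}

theorem Step.chain {k : ℕ} {σ τ : State n} {x y : B × ℝ} (h : K.Step k σ τ x y) :
    K.Chain [(k, τ)] σ τ x y := ⟨y, h, rfl, rfl⟩

theorem Chain.append {L L' : List (ℕ × State n)} {σ ρ τ : State n} {x y z : B × ℝ}
    (h : K.Chain L σ ρ x y) (h' : K.Chain L' ρ τ y z) : K.Chain (L ++ L') σ τ x z := by
  induction L generalizing σ x with
  | nil =>
    obtain ⟨rfl, rfl⟩ := h
    exact h'
  | cons a L ih =>
    obtain ⟨x', hs, hc⟩ := h
    exact ⟨x', hs, ih hc⟩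

variable (K)

/-- The contraction of `dt ∧ ω` with the vector of the state and with the displacements of the points
`x i` relative to `x₀`. -/
noncomputable def flux (σ : State n) (x₀ : B × ℝ) (x : Fin p → B × ℝ) : ℝ :=
  (wedgeHeight (ω.toFun (K.center σ.1))).curryLeft (castVel σ.2)
    fun i => coord (K.center σ.1) (x i) - coord (K.center σ.1) x₀

variable {K} [TropicalAffineManifold n B]

theorem Step.flux_eq {k : ℕ} {σ τ : State n} {x₀ y₀ : B × ℝ} {x y : Fin p → B × ℝ}
    (h₀ : K.Step k σ τ x₀ y₀) (h : ∀ i, K.Step k σ τ (x i) (y i)) :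
    K.flux σ x₀ x = K.flux τ y₀ y := by
  obtain ⟨⟨A, b, hz, hA⟩, hx₀, l₀, hl₀⟩ := h₀
  choose _ hx l hl using h
  have hform := ω.toFun_change (hA _ hx₀).1 (hA _ hx₀).2.1
    (Filter.eventually_of_mem ((K.isOpen_basis k).mem_nhds hx₀) fun y hy => (hA y hy).2.2)
  have e₁ : K.flux σ x₀ x = (wedgeHeight (ω.toFun (K.center τ.1))).curryLeft (castVel τ.2)
      fun i => coord (K.center τ.1) (x i) - coord (K.center τ.1) x₀ := by
    rw [flux, wedgeHeight_curryLeft_map hform, hz, castVel_velAction]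
    congr 1
    funext i
    ext1
    · simp only [coord, Prod.fst_sub]
      rw [(hA _ (hx i)).2.2, (hA _ hx₀).2.2, map_sub]
      abel
    · rfl
  rw [e₁, flux, ← curryLeft_add_smul _ _ _ fun i => l i - l₀]
  congr 1
  funext i
  rw [hl, hl₀, sub_smul]
  abel

theorem Chain.flux_eq {L : List (ℕ × State n)} {σ τ : State n} {x₀ y₀ : B × ℝ}
    {x y : Fin p → B × ℝ} (h₀ : K.Chain L σ τ x₀ y₀) (h : ∀ i, K.Chain L σ τ (x i) (y i)) :
    K.flux σ x₀ x = K.flux τ y₀ y := by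
  induction L generalizing σ x₀ x with
  | nil =>
    obtain ⟨rfl, rfl⟩ := h₀
    rw [funext fun i => (h i).2]
  | cons a L ih =>
    obtain ⟨x₀', hs₀, hc₀⟩ := h₀
    choose x' hs hc using h
    exact (Step.flux_eq hs₀ hs).trans (ih hc₀ hc)

theorem exists_change {x : B} {c c' : ℕ} (hx : x ∈ ω.flatNhd (K.center c))
    (hx' : x ∈ ω.flatNhd (K.center c')) :
    ∃ (A : GL (Fin n) ℤ) (b : Fin n → ℝ) (k : ℕ), x ∈ K.basis k ∧ (∀ᶠ y in 𝓝 x,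
      chartAt (Fin n → ℝ) (K.center c') y =
        realAction A (chartAt (Fin n → ℝ) (K.center c) y) + b) ∧
      ∀ z, K.Change k (c, z) (c', velAction A z) := by
  obtain ⟨A, b, h⟩ := exists_affine_transition (ω.flatNhd_subset _ hx) (ω.flatNhd_subset _ hx')
  obtain ⟨k, hxk, hk⟩ := K.exists_basis x _ (Filter.inter_mem h
    (Filter.inter_mem ((ω.isOpen_flatNhd _).mem_nhds hx) ((ω.isOpen_flatNhd _).mem_nhds hx')))
  exact ⟨A, b, k, hxk, h, fun z => ⟨A, b, rfl, fun y hy =>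
    ⟨(hk hy).2.1, (hk hy).2.2, (hk hy).1⟩⟩⟩

/-- Near a parameter `t`, an affine path is followed by chains, in both directions. -/
theorem eventually_exists_chain {I : Set ℝ} [∀ t : I, (𝓝[≠] t).NeBot] {γ : I → B × ℝ}
    (hγ : Continuous γ) {z : I → (Fin n → ℤ) × ℤ}
    (hz : ∀ t, HasVelocityIn (K.center (K.idx (γ t).1)) γ t (z t)) (t : I) : ∀ᶠ s in 𝓝 t,
      (∃ L, K.Chain L (K.idx (γ t).1, z t) (K.idx (γ s).1, z s) (γ t) (γ s)) ∧
      ∃ L, K.Chain L (K.idx (γ s).1, z s) (K.idx (γ t).1, z t) (γ s) (γ t) := by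
  have hc : Continuous fun s => (γ s).1 := continuous_fst.comp hγ
  have key : ∀ {c : ℕ} {s : I}, (γ s).1 ∈ ω.flatNhd (K.center c) → ∀ {c' : ℕ},
      (γ s).1 ∈ ω.flatNhd (K.center c') → ∀ {w w' : (Fin n → ℤ) × ℤ},
      HasVelocityIn (K.center c) γ s w → HasVelocityIn (K.center c') γ s w' →
      ∃ k, (γ s).1 ∈ K.basis k ∧ K.Change k (c, w) (c', w') := by
    intro c s hs c' hs' w w' hw hw'
    obtain ⟨A, b, k, hk, hA, h⟩ := exists_change hs hs'
    obtain rfl := (hw.change hγ hA).unique hw'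
    exact ⟨k, hk, h w⟩
  have hmem : ∀ᶠ s in 𝓝 t, (γ s).1 ∈ ω.flatNhd (K.center (K.idx (γ t).1)) :=
    hc.continuousAt.eventually ((ω.isOpen_flatNhd _).mem_nhds (K.mem_idx (γ t).1))
  filter_upwards [hz t, (hz t).eventually, hmem] with s hs hv hms
  obtain ⟨k₀, hk₀, h₀⟩ := key (K.mem_idx _) (K.mem_idx _) (hz t) (hz t)
  obtain ⟨k₁, hk₁, h₁⟩ := key hms (K.mem_idx _) hv (hz s)
  obtain ⟨k₂, hk₂, h₂⟩ := key (K.mem_idx _) hms (hz s) hv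
  constructor
  · have s₁ : K.Step k₀ (K.idx (γ t).1, z t) (K.idx (γ t).1, z t) (γ t) (γ s) :=
      ⟨h₀, hk₀, _, hs⟩
    have s₂ : K.Step k₁ (K.idx (γ t).1, z t) (K.idx (γ s).1, z s) (γ s) (γ s) :=
      ⟨h₁, hk₁, 0, by simp⟩
    exact ⟨_, s₁.chain.append s₂.chain⟩
  · have s₁ : K.Step k₂ (K.idx (γ s).1, z s) (K.idx (γ t).1, z t) (γ s) (γ t) :=
      ⟨h₂, hk₂, -((s : ℝ) - t), by rw [hs, add_assoc, ← add_smul]; simp⟩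
    exact ⟨_, s₁.chain⟩

theorem exists_chain {I : Set ℝ} [PreconnectedSpace I] [∀ t : I, (𝓝[≠] t).NeBot]
    {γ : I → B × ℝ} (hγ : Continuous γ) {z : I → (Fin n → ℤ) × ℤ}
    (hz : ∀ t, HasVelocityIn (K.center (K.idx (γ t).1)) γ t (z t)) (s t : I) :
    ∃ L, K.Chain L (K.idx (γ s).1, z s) (K.idx (γ t).1, z t) (γ s) (γ t) := by
  refine PreconnectedSpace.induction₂' (fun s t : I =>
    ∃ L, K.Chain L (K.idx (γ s).1, z s) (K.idx (γ t).1, z t) (γ s) (γ t))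
    (eventually_exists_chain hγ hz) ⟨?_⟩ s t
  rintro a b c ⟨L, h⟩ ⟨L', h'⟩
  exact ⟨_, h.append h'⟩

end FlatCover

end Cover

/-- The discrete data of a tropical curve followed through a countable cover by charts: the bounded
part of the graph, the total momentum of the rays at each vertex, the chart used at each vertex, and
for each edge the initial and final velocities and the sequence of charts along the edge. -/
structure GraphType (n : ℕ) where
  /-- number of vertices -/
  numV : ℕ
  /-- number of edges -/
  numE : ℕ
  /-- initial vertex of an edge -/
  src : Fin numE → Fin numV
  /-- final vertex of an edge -/
  tgt : Fin numE → Fin numV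
  /-- total momentum of the rays at a vertex -/
  weight : Fin numV → ℤ
  /-- chart at a vertex -/
  idx : Fin numV → ℕ
  /-- initial velocity of an edge -/
  velSrc : Fin numE → (Fin n → ℤ) × ℤ
  /-- final velocity of an edge -/
  velTgt : Fin numE → (Fin n → ℤ) × ℤ
  /-- charts along an edge -/
  path : Fin numE → List (ℕ × ℕ × ((Fin n → ℤ) × ℤ))

instance (n : ℕ) : Countable (GraphType n) := by
  let f : GraphType n → Σ (V : ℕ) (E : ℕ), (Fin E → Fin V) × (Fin E → Fin V) × (Fin V → ℤ) ×
      (Fin V → ℕ) × (Fin E → (Fin n → ℤ) × ℤ) × (Fin E → (Fin n → ℤ) × ℤ) ×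
      (Fin E → List (ℕ × ℕ × ((Fin n → ℤ) × ℤ))) := fun τ =>
    ⟨τ.numV, τ.numE, τ.src, τ.tgt, τ.weight, τ.idx, τ.velSrc, τ.velTgt, τ.path⟩
  refine Function.Injective.countable (f := f) ?_
  rintro ⟨V, E, _, _, _, _, _, _, _⟩ ⟨V', E', _, _, _, _, _, _, _⟩ h
  simp only [f, Sigma.mk.injEq] at h
  obtain ⟨rfl, h⟩ := h
  simp only [heq_eq_eq, Sigma.mk.injEq] at h
  obtain ⟨rfl, h⟩ := h
  simp only [heq_eq_eq, Prod.mk.injEq] at h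
  obtain ⟨rfl, rfl, rfl, rfl, rfl, rfl, rfl⟩ := h
  rfl

section Realizations

variable {n : ℕ} {B : Type*} [TopologicalSpace B] [ChartedSpace (Fin n → ℝ) B] {p : ℕ}
  {ω : TropicalForm n B p}

/-- A placement of the vertices in `B × ℝ` that is compatible with the discrete data. -/
structure GraphType.Realizes (K : FlatCover ω) (τ : GraphType n) (pos : Fin τ.numV → B × ℝ) :
    Prop where
  idx_eq : ∀ v, K.idx (pos v).1 = τ.idx v
  path_chain : ∀ e, K.Chain (τ.path e) (τ.idx (τ.src e), τ.velSrc e) (τ.idx (τ.tgt e), τ.velTgt e)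
    (pos (τ.src e)) (pos (τ.tgt e))
  balanced : ∀ v, ∑ e ∈ Finset.univ.filter (fun e => τ.src e = v), τ.velSrc e
    - ∑ e ∈ Finset.univ.filter (fun e => τ.tgt e = v), τ.velTgt e + (0, τ.weight v) = 0

/-- Realizations of the same discrete data satisfy the conservation law for `ω`. -/
theorem GraphType.Realizes.sum_eq_zero [TropicalAffineManifold n B] {K : FlatCover ω}
    {τ : GraphType n} {pos₀ : Fin τ.numV → B × ℝ} {pos : Fin p → Fin τ.numV → B × ℝ}
    (h₀ : τ.Realizes K pos₀) (h : ∀ i, τ.Realizes K (pos i)) :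
    ∑ v, (τ.weight v : ℝ) * ω.toFun (K.center (τ.idx v)) (fun i =>
      chartAt (Fin n → ℝ) (K.center (τ.idx v)) (pos i v).1 -
        chartAt (Fin n → ℝ) (K.center (τ.idx v)) (pos₀ v).1) = 0 := by
  set F : Fin τ.numV → (Fin n → ℤ) × ℤ → ℝ := fun v z =>
    K.flux (τ.idx v, z) (pos₀ v) fun i => pos i v with hF
  have hadd : ∀ v z z', F v (z + z') = F v z + F v z' := by
    intro v z z'
    simp only [hF, FlatCover.flux, map_add, AlternatingMap.add_apply]
  let G : Fin τ.numV → (Fin n → ℤ) × ℤ →+ ℝ := fun v => AddMonoidHom.mk' (F v) (hadd v)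
  have hflux : ∀ e, G (τ.src e) (τ.velSrc e) = G (τ.tgt e) (τ.velTgt e) := fun e =>
    (h₀.path_chain e).flux_eq fun i => (h i).path_chain e
  have hvert : ∀ v, (τ.weight v : ℝ) * ω.toFun (K.center (τ.idx v)) (fun i =>
      chartAt (Fin n → ℝ) (K.center (τ.idx v)) (pos i v).1 -
        chartAt (Fin n → ℝ) (K.center (τ.idx v)) (pos₀ v).1) = G v (0, τ.weight v) := by
    intro v
    have : castVel ((0, τ.weight v) : (Fin n → ℤ) × ℤ) = (0, (τ.weight v : ℝ)) := by
      rw [castVel_apply]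
      ext <;> simp
    simp only [G, AddMonoidHom.mk'_apply, hF, FlatCover.flux]
    rw [this, wedgeHeight_curryLeft_vertical]
    rfl
  have hsrc : ∑ v, ∑ e ∈ Finset.univ.filter (fun e => τ.src e = v), G v (τ.velSrc e) =
      ∑ e, G (τ.src e) (τ.velSrc e) := by
    rw [← Finset.sum_fiberwise _ τ.src]
    refine Finset.sum_congr rfl fun v _ => Finset.sum_congr rfl fun e he => ?_
    rw [(Finset.mem_filter.1 he).2]
  have htgt : ∑ v, ∑ e ∈ Finset.univ.filter (fun e => τ.tgt e = v), G v (τ.velTgt e) =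
      ∑ e, G (τ.tgt e) (τ.velTgt e) := by
    rw [← Finset.sum_fiberwise _ τ.tgt]
    refine Finset.sum_congr rfl fun v _ => Finset.sum_congr rfl fun e he => ?_
    rw [(Finset.mem_filter.1 he).2]
  have hbal := Finset.sum_congr (rfl : (Finset.univ : Finset (Fin τ.numV)) = Finset.univ)
    fun v _ => congrArg (G v) (h₀.balanced v)
  simp only [map_add, map_sub, map_sum, map_zero, Finset.sum_add_distrib, Finset.sum_sub_distrib,
    Finset.sum_const_zero] at hbal
  rw [hsrc, htgt, Finset.sum_congr rfl fun e _ => hflux e, sub_self, zero_add] at hbal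
  rw [← hbal]
  exact Finset.sum_congr rfl fun v _ => hvert v

end Realizations

section Curves

variable {n : ℕ} {B : Type*} [TopologicalSpace B] [ChartedSpace (Fin n → ℝ) B]

theorem AbstractTropicalCurve.edgePt_first (G : AbstractTropicalCurve) (e : Fin G.numE) :
    G.edgePt e (G.first e) = G.vertexPt (G.src e) := Quot.sound (.src e)

theorem AbstractTropicalCurve.edgePt_last (G : AbstractTropicalCurve) (e : Fin G.numE) :
    G.edgePt e (G.last e) = G.vertexPt (G.tgt e) := Quot.sound (.tgt e)

theorem AbstractTropicalCurve.rayPt_origin (G : AbstractTropicalCurve) (u : Fin G.numU) :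
    G.rayPt u AbstractTropicalCurve.origin = G.vertexPt (G.root u) := Quot.sound (.root u)

theorem AbstractTropicalCurve.continuous_edgePt (G : AbstractTropicalCurve) (e : Fin G.numE) :
    Continuous (G.edgePt e) :=
  continuous_quot_mk.comp (continuous_inr.comp (continuous_inl.comp continuous_sigmaMk))

namespace TropicalCurve

variable (C : TropicalCurve n B)

instance (t : Set.Ici (0 : ℝ)) : (𝓝[≠] t).NeBot := by
  have : Nontrivial (Set.Ici (0 : ℝ)) := ⟨⟨0, by simp⟩, ⟨1, by simp⟩, by simp⟩
  have : ConnectedSpace (Set.Ici (0 : ℝ)) := Subtype.connectedSpace isConnected_Ici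
  exact ConnectedSpace.neBot_nhdsWithin_compl_of_nontrivial_of_t1space t

theorem nhdsNE_neBot_Icc {l : ℝ} (hl : 0 < l) (t : Set.Icc (0 : ℝ) l) : (𝓝[≠] t).NeBot := by
  have : Nontrivial (Set.Icc (0 : ℝ) l) :=
    ⟨⟨0, by simp [hl.le]⟩, ⟨l, by simp [hl.le]⟩, by simp [hl.ne]⟩
  have : ConnectedSpace (Set.Icc (0 : ℝ) l) := Subtype.connectedSpace (isConnected_Icc hl.le)
  exact ConnectedSpace.neBot_nhdsWithin_compl_of_nontrivial_of_t1space t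

variable {C}

theorem HorizontalAtInfinity.rayVel_fst (hC : C.HorizontalAtInfinity) (u : Fin C.G.numU) :
    (C.rayVel u AbstractTropicalCurve.origin).1 = 0 := by
  have h := (C.ray_affine u AbstractTropicalCurve.origin).hasVelocityIn
  have h' : HasVelocityIn (n := n) (C.h (C.G.rayPt u AbstractTropicalCurve.origin)).1
      (fun s => C.h (C.G.rayPt u s)) AbstractTropicalCurve.origin
      (0, (C.rayVel u AbstractTropicalCurve.origin).2) := by
    filter_upwards [h] with s hs
    refine Prod.ext ?_ (Prod.ext_iff.1 hs).2
    simp only [coord, castVel_apply]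
    rw [hC u s, endPoint]
    simp only [Pi.zero_apply, Int.cast_zero, Prod.fst_add, Prod.smul_fst]
    rw [show (fun _ : Fin n => (0 : ℝ)) = 0 from rfl, smul_zero, add_zero]
  exact congrArg Prod.fst (h.unique h')

theorem HorizontalAtInfinity.cycle_eq (hC : C.HorizontalAtInfinity) : C.cycle =
    ∑ u, Finsupp.single (C.endPoint u) (C.rayVel u AbstractTropicalCurve.origin).2 := by
  have hw : ∀ u, C.weight u = (C.rayVel u AbstractTropicalCurve.origin).2.natAbs := by
    intro u
    have : (Finset.univ.gcd fun i : Fin n => ((0 : Fin n → ℤ) i).natAbs) = 0 :=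
      Finset.gcd_eq_zero_iff.2 (by simp)
    rw [weight, hC.rayVel_fst u, this, Nat.gcd_zero_left]
  rw [cycle, endsPlus, endsMinus, Finset.sum_filter, Finset.sum_filter, ← Finset.sum_sub_distrib]
  refine Finset.sum_congr rfl fun u _ => ?_
  rw [hw]
  obtain h | h | h := lt_trichotomy (C.rayVel u AbstractTropicalCurve.origin).2 0
  · rw [if_neg h.not_gt, if_pos h, zero_sub, ← Finsupp.single_neg]
    congr 1
    omega
  · simp [h]
  · rw [if_pos h, if_neg h.not_gt, sub_zero]
    congr 1
    omega

theorem HorizontalAtInfinity.exists_realizes [TropicalAffineManifold n B] {p : ℕ}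
    {ω : TropicalForm n B p} (K : FlatCover ω) (hC : C.HorizontalAtInfinity) :
    ∃ (τ : GraphType n) (pos : Fin τ.numV → B × ℝ), τ.Realizes K pos ∧
      C.cycle = ∑ v, Finsupp.single (pos v).1 (τ.weight v) := by
  choose A b hA using fun x : B => exists_affine_transition (n := n) (mem_chart_source _ x)
    (ω.flatNhd_subset _ (K.mem_idx x))
  have hcont : ∀ e, Continuous fun s => C.h (C.G.edgePt e s) := fun e =>
    C.isClosedEmbedding.continuous.comp (C.G.continuous_edgePt e)
  let vel : ∀ e : Fin C.G.numE, Set.Icc (0 : ℝ) (C.G.len e) → (Fin n → ℤ) × ℤ := fun e t =>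
    velAction (A (C.h (C.G.edgePt e t)).1) (C.edgeVel e t)
  have hvel : ∀ e t, HasVelocityIn (K.center (K.idx (C.h (C.G.edgePt e t)).1))
      (fun s => C.h (C.G.edgePt e s)) t (vel e t) := fun e t =>
    (C.edge_affine e t).hasVelocityIn.change (hcont e) (hA _)
  have hchain : ∀ e, ∃ L, K.Chain L
      (K.idx (C.h (C.G.vertexPt (C.G.src e))).1, vel e (C.G.first e))
      (K.idx (C.h (C.G.vertexPt (C.G.tgt e))).1, vel e (C.G.last e))
      (C.h (C.G.vertexPt (C.G.src e))) (C.h (C.G.vertexPt (C.G.tgt e))) := by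
    intro e
    have := fun t => nhdsNE_neBot_Icc (C.G.len_pos e) t
    have : PreconnectedSpace (Set.Icc (0 : ℝ) (C.G.len e)) :=
      Subtype.preconnectedSpace isPreconnected_Icc
    have h := FlatCover.exists_chain (hcont e) (hvel e) (C.G.first e) (C.G.last e)
    simpa only [C.G.edgePt_first, C.G.edgePt_last] using h
  choose L hL using hchain
  refine ⟨⟨C.G.numV, C.G.numE, C.G.src, C.G.tgt,
    fun v => ∑ u ∈ Finset.univ.filter (fun u => C.G.root u = v),
      (C.rayVel u AbstractTropicalCurve.origin).2,
    fun v => K.idx (C.h (C.G.vertexPt v)).1, fun e => vel e (C.G.first e),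
    fun e => vel e (C.G.last e), L⟩, fun v => C.h (C.G.vertexPt v), ⟨fun _ => rfl, hL, ?_⟩, ?_⟩
  · intro v
    have h := congrArg (velAction (A (C.h (C.G.vertexPt v)).1)) (C.balanced v)
    rw [map_add, map_sub, map_sum, map_sum, map_sum, map_zero] at h
    rw [← h]
    congr 1
    · congr 1
      · refine Finset.sum_congr rfl fun e he => ?_
        simp only [vel]
        rw [C.G.edgePt_first, (Finset.mem_filter.1 he).2]
      · refine Finset.sum_congr rfl fun e he => ?_
        simp only [vel]
        rw [C.G.edgePt_last, (Finset.mem_filter.1 he).2]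
    · have : ∀ u, velAction (A (C.h (C.G.vertexPt v)).1)
          (C.rayVel u AbstractTropicalCurve.origin) =
          AddMonoidHom.inr (Fin n → ℤ) ℤ (C.rayVel u AbstractTropicalCurve.origin).2 := by
        intro u
        rw [velAction_apply, hC.rayVel_fst u, Matrix.mulVec_zero]
        rfl
      simp only [this]
      rw [← map_sum]
      rfl
  · rw [hC.cycle_eq, ← Finset.sum_fiberwise _ C.G.root]
    refine Finset.sum_congr rfl fun v _ => ?_
    change _ = Finsupp.singleAddHom (C.h (C.G.vertexPt v)).1
      (∑ u ∈ Finset.univ.filter (fun u => C.G.root u = v),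
        (C.rayVel u AbstractTropicalCurve.origin).2)
    rw [map_sum]
    refine Finset.sum_congr rfl fun u hu => ?_
    rw [endPoint, C.G.rayPt_origin, (Finset.mem_filter.1 hu).2]
    rfl

end TropicalCurve

end Curves

section Relations

variable {n : ℕ} {B : Type*} [TopologicalSpace B] [ChartedSpace (Fin n → ℝ) B] {p : ℕ}
  {ω : TropicalForm n B p}

theorem exists_sum_of_mem_relations {z : B →₀ ℤ} (hz : z ∈ relations n B) :
    ∃ (N : ℕ) (ε : Fin N → ℤ) (C : Fin N → TropicalCurve n B),
      (∀ j, (C j).HorizontalAtInfinity) ∧ z = ∑ j, ε j • (C j).cycle := by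
  rw [relations, ← Submodule.span_int_eq_addSubgroupClosure, Submodule.mem_toAddSubgroup,
    Submodule.mem_span_set'] at hz
  obtain ⟨N, ε, g, hg⟩ := hz
  choose C hC hc using fun j => (g j).2
  exact ⟨N, ε, C, hC, by simp only [hc, hg]⟩

/-- The tuples of points satisfying a given linear relation in `CH₀(B)` are covered by countably many
families, each of which satisfies the conservation law for `ω`. -/
theorem exists_countable_conservation [TropicalAffineManifold n B] (K : FlatCover ω)
    {R : Type} [Fintype R] (c : R → ℤ) :
    ∃ (T : Type) (_ : Countable T) (S : T → Set (R → B)) (I : T → R → ℕ),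
      (∀ x : R → B, ∑ r, Finsupp.single (x r) (c r) ∈ relations n B → ∃ t, x ∈ S t) ∧
      (∀ t, ∀ x ∈ S t, ∀ r, K.idx (x r) = I t r) ∧
      ∀ t, ∀ x₀ ∈ S t, ∀ x : Fin p → R → B, (∀ i, x i ∈ S t) →
        ∑ r, (c r : ℝ) * ω.toFun (K.center (I t r)) (fun i =>
          chartAt (Fin n → ℝ) (K.center (I t r)) (x i r) -
            chartAt (Fin n → ℝ) (K.center (I t r)) (x₀ r)) = 0 := by
  let Q : ∀ N : ℕ, (Fin N → ℤ × GraphType n) → Type := fun N τ =>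
    (Σ j, Fin (τ j).2.numV) ⊕ R
  let T : Type := Σ (N : ℕ) (τ : Fin N → ℤ × GraphType n),
    (Q N τ → ℕ) × (Q N τ → Q N τ → Prop)
  have hT : Countable T := inferInstance
  let pt : ∀ (N : ℕ) (τ : Fin N → ℤ × GraphType n)
      (pos : ∀ j, Fin (τ j).2.numV → B × ℝ) (x : R → B), Q N τ → B := fun N τ pos x =>
    Sum.elim (fun q => (pos q.1 q.2).1) x
  refine ⟨T, hT, fun t => {x | ∃ pos : ∀ j, Fin (t.2.1 j).2.numV → B × ℝ,
      (∀ j, (t.2.1 j).2.Realizes K (pos j)) ∧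
      (∀ q, K.idx (pt _ _ pos x q) = t.2.2.1 q) ∧
      (∀ q q', t.2.2.2 q q' ↔ pt _ _ pos x q = pt _ _ pos x q') ∧
      ∑ r, Finsupp.single (x r) (c r) = ∑ j, (t.2.1 j).1 •
        ∑ v, Finsupp.single (pos j v).1 ((t.2.1 j).2.weight v)},
    fun t r => t.2.2.1 (Sum.inr r), ?_, ?_, ?_⟩
  · intro x hx
    obtain ⟨N, ε, C, hC, h⟩ := exists_sum_of_mem_relations hx
    choose τ pos hτ hcyc using fun j => (hC j).exists_realizes K
    refine ⟨⟨N, fun j => (ε j, τ j), fun q => K.idx (pt N (fun j => (ε j, τ j)) pos x q),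
      fun q q' => pt N (fun j => (ε j, τ j)) pos x q = pt N (fun j => (ε j, τ j)) pos x q'⟩,
      pos, hτ, fun _ => rfl, fun _ _ => Iff.rfl, ?_⟩
    rw [h]
    exact Finset.sum_congr rfl fun j _ => by rw [hcyc j]
  · rintro t x ⟨pos, -, hidx, -⟩ r
    exact hidx (Sum.inr r)
  · rintro ⟨N, τ, I, P⟩ x₀ ⟨pos₀, hr₀, hidx₀, hpat₀, hsum₀⟩ x hx
    choose pos hr hidx hpat hsum using hx
    dsimp only at *
    set V : Q N τ → ℝ := fun q => ω.toFun (K.center (I q)) (fun i =>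
      chartAt (Fin n → ℝ) (K.center (I q)) (pt N τ (pos i) (x i) q) -
        chartAt (Fin n → ℝ) (K.center (I q)) (pt N τ pos₀ x₀ q)) with hV
    have hfac : V.FactorsThrough (pt N τ pos₀ x₀) := by
      intro q q' hq
      have h₁ : ∀ i, pt N τ (pos i) (x i) q = pt N τ (pos i) (x i) q' := fun i =>
        (hpat i q q').1 ((hpat₀ q q').2 hq)
      have h₂ : I q = I q' := by rw [← hidx₀ q, ← hidx₀ q', hq]
      simp only [hV, h₁, h₂, hq]
    set F : B → ℝ := Function.extend (pt N τ pos₀ x₀) V 0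
    have hF : ∀ q, F (pt N τ pos₀ x₀ q) = V q := fun q => hfac.extend_apply 0 q
    let Φ : (B →₀ ℤ) →+ ℝ := Finsupp.liftAddHom fun b =>
      (AddMonoidHom.mulRight (F b)).comp (Int.castAddHom ℝ)
    have hΦ : ∀ b a, Φ (Finsupp.single b a) = a * F b := fun b a => by simp [Φ]
    have h := congrArg Φ hsum₀
    simp only [map_sum, map_zsmul, hΦ] at h
    have hR : ∀ r, F (x₀ r) = V (Sum.inr r) := fun r => hF (Sum.inr r)
    have hQ : ∀ j v, F (pos₀ j v).1 = V (Sum.inl ⟨j, v⟩) := fun j v => hF (Sum.inl ⟨j, v⟩)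
    simp only [hR, hQ] at h
    refine h.trans (Finset.sum_eq_zero fun j _ => ?_)
    have hcons := (hr₀ j).sum_eq_zero fun i => hr i j
    have hI : ∀ v, I (Sum.inl ⟨j, v⟩) = (τ j).2.idx v := fun v => by
      rw [← hidx₀, ← (hr₀ j).idx_eq]
      rfl
    have : ∑ v, ((τ j).2.weight v : ℝ) * V (Sum.inl ⟨j, v⟩) = 0 := by
      rw [← hcons]
      refine Finset.sum_congr rfl fun v _ => ?_
      simp only [hV, hI]
      rfl
    rw [this, smul_zero]

end Relations

section LinearAlgebra

/-- A form that is determined by differences of points of a spanning set through a map to `W` is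
pulled back from `W` by a linear map. -/
theorem exists_linearMap_of_affineSpan_eq_top {p : ℕ} {V W : Type*} [AddCommGroup V] [Module ℝ V]
    [AddCommGroup W] [Module ℝ W] {S : Set V} (hS : affineSpan ℝ S = ⊤) {s₀ : V} (hs₀ : s₀ ∈ S)
    (F : MultilinearMap ℝ (fun _ : Fin p => V) ℝ) (G : MultilinearMap ℝ (fun _ : Fin p => W) ℝ)
    (β : V → W) (h : ∀ s : Fin p → V, (∀ i, s i ∈ S) →
      F (fun i => s i - s₀) = G (fun i => β (s i) - β s₀)) :
    ∃ φ : V →ₗ[ℝ] W, F = G.compLinearMap fun _ => φ := by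
  have hspan : Submodule.span ℝ ((fun x => x -ᵥ s₀) '' S) = ⊤ := by
    rw [← vectorSpan_eq_span_vsub_set_right ℝ hs₀, ← direction_affineSpan, hS,
      AffineSubspace.direction_top]
  obtain ⟨b, hb, hbs, hli⟩ := exists_linearIndependent ℝ ((fun x => x -ᵥ s₀) '' S)
  choose s hs hsb using fun x : b => hb x.2
  let e : Module.Basis b ℝ V := Module.Basis.mk hli (by
    rw [Subtype.range_coe, hbs, hspan])
  have he : ∀ x, e x = s x - s₀ := fun x => by
    rw [Module.Basis.mk_apply]
    exact (hsb x).symm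
  refine ⟨e.constr ℝ fun x => β (s x) - β s₀, Module.Basis.ext_multilinear (fun _ => e) fun v => ?_⟩
  simp only [MultilinearMap.compLinearMap_apply, Module.Basis.constr_basis]
  simp only [he]
  exact h _ fun i => hs _

/-- The sum of `m` copies of a nonzero form of degree at least two is not pulled back from a space of
dimension less than `m`. -/
theorem le_finrank_of_sum_eq_compLinearMap {p m : ℕ} (hp : 2 ≤ p) {E W : Type*} [AddCommGroup E]
    [Module ℝ E] [AddCommGroup W] [Module ℝ W] [FiniteDimensional ℝ W]
    (f : E [⋀^Fin p]→ₗ[ℝ] ℝ) {u : Fin p → E} (hu : f u ≠ 0)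
    (G : MultilinearMap ℝ (fun _ : Fin p => W) ℝ) (φ : (Fin m → E) →ₗ[ℝ] W)
    (h : ∀ v : Fin p → Fin m → E, ∑ j, f (fun i => v i j) = G fun i => φ (v i)) :
    m ≤ Module.finrank ℝ W := by
  classical
  let i₀ : Fin p := ⟨0, by omega⟩
  let i₁ : Fin p := ⟨1, by omega⟩
  let ψ : (Fin m → ℝ) →ₗ[ℝ] W :=
    φ.comp (LinearMap.pi fun j => (LinearMap.proj j).smulRight (u i₀))
  have hψ : Function.Injective ψ := by
    rw [injective_iff_map_eq_zero]
    intro c hc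
    funext j₀
    let v : Fin p → Fin m → E := fun i =>
      if i = i₀ then fun j => c j • u i₀ else Pi.single j₀ (u i)
    have h₁ : G (fun i => φ (v i)) = 0 := G.map_coord_zero i₀ (by
      simp only [v, if_true]
      exact hc)
    have h₂ : ∀ j ≠ j₀, f (fun i => v i j) = 0 := fun j hj =>
      f.map_coord_zero i₁ (by simp [v, i₀, i₁, hj])
    have h₃ : (fun i => v i j₀) = Function.update u i₀ (c j₀ • u i₀) := by
      funext i
      by_cases hi : i = i₀
      · subst hi
        simp [v]
      · simp [v, hi]
    have h₄ := h v
    rw [h₁, Finset.sum_eq_single j₀ (fun j _ hj => h₂ j hj) (by simp), h₃,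
      AlternatingMap.map_update_smul, Function.update_eq_self, smul_eq_mul] at h₄
    exact (mul_eq_zero.1 h₄).resolve_right hu
  simpa using LinearMap.finrank_le_finrank_of_injective hψ

end LinearAlgebra

theorem exists_affineSpan_eq_top {V : Type*} [NormedAddCommGroup V] [NormedSpace ℝ V]
    [FiniteDimensional ℝ V] {T : Type*} [Countable T] {O : Set V} (hO : IsOpen O)
    (hne : O.Nonempty) (S : T → Set V) (hS : O ⊆ ⋃ t, S t) : ∃ t, affineSpan ℝ (S t) = ⊤ := by
  borelize V
  by_contra! h
  have h0 : (MeasureTheory.Measure.addHaar : MeasureTheory.Measure V) O = 0 :=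
    MeasureTheory.measure_mono_null hS (MeasureTheory.measure_iUnion_null fun t =>
      MeasureTheory.measure_mono_null (subset_affineSpan ℝ (S t))
        (MeasureTheory.Measure.addHaar_affineSubspace _ _ (h t)))
  exact (hO.measure_pos _ hne).ne' h0

section Main

variable {n : ℕ} {B : Type*} [TopologicalSpace B] [ChartedSpace (Fin n → ℝ) B]

theorem exists_sub_diffCycle_mem_relations {k : ℕ} (hk : Function.Surjective (diffMap n B k))
    {z : B →₀ ℤ} (hz : z ∈ (degree B).ker) :
    ∃ b : (Fin k → B) × (Fin k → B), z - diffCycle b ∈ relations n B := by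
  obtain ⟨b, hb⟩ := hk ⟨QuotientAddGroup.mk' (relations n B) z, AddSubgroup.mem_map_of_mem _ hz⟩
  refine ⟨b, ?_⟩
  have := congrArg Subtype.val hb
  rw [sub_eq_neg_add]
  exact QuotientAddGroup.eq.1 this

theorem infiniteDimensional_of_form [SecondCountableTopology B] [TropicalAffineManifold n B]
    {p : ℕ} (hp : 2 ≤ p) (ω : TropicalForm n B p) (hω : ω.toFun ≠ 0) :
    InfiniteDimensional n B := by
  intro k hk
  obtain ⟨x₀, hx₀⟩ := Function.ne_iff.1 hω
  obtain ⟨u, hu⟩ : ∃ u, ω.toFun x₀ u ≠ 0 := by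
    by_contra! h
    exact hx₀ (AlternatingMap.ext h)
  obtain ⟨K, hK⟩ := exists_flatCover ω x₀
  let W : Type := Fin k ⊕ Fin k → Fin n → ℝ
  let m : ℕ := Module.finrank ℝ W + 1
  let V : Type := Fin m → Fin n → ℝ
  let e := chartAt (Fin n → ℝ) x₀
  let O : Set (Fin n → ℝ) := e '' ω.flatNhd x₀
  have hO : IsOpen O :=
    e.isOpen_image_of_subset_source (ω.isOpen_flatNhd x₀) (ω.flatNhd_subset x₀)
  have hO' : ∀ y ∈ O, e.symm y ∈ ω.flatNhd x₀ ∧ e (e.symm y) = y := by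
    rintro _ ⟨x, hx, rfl⟩
    rw [e.left_inv (ω.flatNhd_subset x₀ hx)]
    exact ⟨hx, rfl⟩
  let R : Type := (Fin m ⊕ (Fin k ⊕ Fin k)) ⊕ Unit
  let c : R → ℤ := Sum.elim (Sum.elim (fun _ => 1) (Sum.elim (fun _ => -1) fun _ => 1))
    fun _ => -m
  let X : V → (Fin k ⊕ Fin k → B) → R → B := fun a b =>
    Sum.elim (Sum.elim (fun j => e.symm (a j)) b) fun _ => x₀
  have hex : ∀ a : V, ∃ b, ∑ r, Finsupp.single (X a b r) (c r) ∈ relations n B := by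
    intro a
    obtain ⟨b, hb⟩ := exists_sub_diffCycle_mem_relations hk
      (z := ∑ j, Finsupp.single (e.symm (a j)) 1 - Finsupp.single x₀ (m : ℤ)) (by
        rw [AddMonoidHom.mem_ker, degree, map_sub, map_sum]
        simp)
    refine ⟨Sum.elim b.1 b.2, ?_⟩
    convert hb using 1
    simp only [R, X, c, diffCycle, Fintype.sum_sum_type, Sum.elim_inl, Sum.elim_inr,
      Finset.sum_sub_distrib, Finset.univ_unique, Finset.sum_singleton, Finsupp.single_neg,
      Finset.sum_neg_distrib]
    abel
  choose b hb using hex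
  obtain ⟨T, _, S, I, hS, hI, hcons⟩ := exists_countable_conservation K c
  let S' : T → Set V := fun t => {a | (∀ j, a j ∈ O) ∧ X a (b a) ∈ S t}
  obtain ⟨t, ht⟩ : ∃ t, affineSpan ℝ (S' t) = ⊤ := by
    refine exists_affineSpan_eq_top (O := {a : V | ∀ j, a j ∈ O}) ?_ ?_ S' ?_
    · simp only [Set.ofPred_forall]
      exact isOpen_iInter_of_finite fun j => hO.preimage (continuous_apply j)
    · exact ⟨fun _ => e x₀, fun _ =>
        Set.mem_image_of_mem _ (mem_of_mem_nhds (ω.flatNhd_mem_nhds x₀))⟩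
    · intro a ha
      obtain ⟨t, ht⟩ := hS _ (hb a)
      exact Set.mem_iUnion.2 ⟨t, ha, ht⟩
  obtain ⟨s₀, hs₀⟩ : (S' t).Nonempty := by
    rw [← affineSpan_nonempty ℝ, ht]
    exact ⟨0, trivial⟩
  let J : Fin k ⊕ Fin k → B := fun r => K.center (I t (Sum.inl (Sum.inr r)))
  let F : MultilinearMap ℝ (fun _ : Fin p => V) ℝ :=
    ∑ j : Fin m, ((ω.toFun x₀).compLinearMap (LinearMap.proj j)).toMultilinearMap
  let G : MultilinearMap ℝ (fun _ : Fin p => W) ℝ :=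
    ∑ r : Fin k ⊕ Fin k, (-(c (Sum.inl (Sum.inr r))) : ℝ) •
      ((ω.toFun (J r)).compLinearMap (LinearMap.proj r)).toMultilinearMap
  have hF : ∀ v, F v = ∑ j, ω.toFun x₀ fun i => v i j := fun v => by
    simp only [F, sum_apply]
    rfl
  have hG : ∀ v, G v = ∑ r, (-(c (Sum.inl (Sum.inr r))) : ℝ) * ω.toFun (J r) fun i => v i r :=
    fun v => by
    simp only [G, sum_apply]
    rfl
  obtain ⟨φ, hφ⟩ := exists_linearMap_of_affineSpan_eq_top ht hs₀ F G
    (fun a r => chartAt (Fin n → ℝ) (J r) (b a r)) (by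
      intro s hs
      have h := hcons t _ hs₀.2 (fun i => X (s i) (b (s i))) fun i => (hs i).2
      have hcen : ∀ j, K.center (I t (Sum.inl (Sum.inl j))) = x₀ := fun j => by
        rw [← hI t _ hs₀.2]
        exact (hK _ (hO' _ (hs₀.1 j)).1)
      rw [Fintype.sum_sum_type, Fintype.sum_sum_type] at h
      have hunit : ∀ w : Unit, ω.toFun (K.center (I t (Sum.inr w))) (fun i =>
          chartAt (Fin n → ℝ) (K.center (I t (Sum.inr w))) (X (s i) (b (s i)) (Sum.inr w)) -
            chartAt (Fin n → ℝ) (K.center (I t (Sum.inr w))) (X s₀ (b s₀) (Sum.inr w))) = 0 :=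
        fun w => AlternatingMap.map_coord_zero _ ⟨0, by omega⟩ (sub_self _)
      simp only [hunit, mul_zero, Finset.sum_const_zero, add_zero] at h
      rw [hF, hG]
      simp only [neg_mul, Finset.sum_neg_distrib]
      rw [eq_neg_iff_add_eq_zero, ← h]
      congr 1
      refine Finset.sum_congr rfl fun j _ => ?_
      rw [hcen]
      simp only [X, c, Sum.elim_inl, Int.cast_one, one_mul]
      congr 1
      funext i
      exact (congrArg₂ (· - ·) (hO' _ ((hs i).1 j)).2 (hO' _ (hs₀.1 j)).2).symm)
  have hle : m ≤ Module.finrank ℝ W :=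
    le_finrank_of_sum_eq_compLinearMap hp (ω.toFun x₀) hu G φ fun v => by
      rw [← hF, hφ]
      rfl
  omega

end Main

end TropicalChow

theorem theorem3 (n : ℕ) (B : Type*) [TopologicalSpace B] [T2Space B] [SecondCountableTopology B]
    [ChartedSpace (Fin n → ℝ) B] [TropicalChow.TropicalAffineManifold n B]
    (p : ℕ) (hp : 2 ≤ p) (ω : TropicalChow.TropicalForm n B p) (hω : ω.toFun ≠ 0) :
    TropicalChow.InfiniteDimensional n B :=
  TropicalChow.infiniteDimensional_of_form hp ω hω
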